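/- Let $d \ge 3$, $c \ge 0$ and $0 \le j \le d-1$ be integers. Let $\mathbf e_1,\dots,\mathbf e_d$ be the canonical unit coordinate vectors of $\mathbb R^d$ and $\mathbf w = -\mathbf e_1-\cdots-\mathbf e_{d-1}$. Let $\mathcal Q_j(c)\subset\mathbb R^d$ be the polytope of prism type, i.e. the convex hull of \[ \mathbf e_1,\dots,\mathbf e_{d-1},\ \mathbf w,\ (c+1)\mathbf e_d,\ \mathbf e_1+(c+1)\mathbf e_d,\dots,\mathbf e_j+(c+1)\mathbf e_d,\ \mathbf e_{j+1}+c\,\mathbf e_d,\dots,\mathbf e_{d-1}+c\,\mathbf e_d,\ \mathbf w+c\,\mathbf e_d . \] For a lattice polytope $\mathcal P\subset\mathbb R^d$ of dimension $d$ let $b(\mathcal P)$ and $c(\mathcal P)$ denote the numbers of points of $\mathbb Z^d$ on the boundary and in the interior of $\mathcal P$, and let $\mathrm{vol}(\mathcal P)$ be its Lebesgue volume. Such a $\mathcal P$ with $c(\mathcal P)>0$ is called Castelnuovo if $\mathrm{vol}(\mathcal P) = \bigl(d\cdot c(\mathcal P)+(d-1)\,b(\mathcal P)-d^2+2\bigr)/d!$.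 Then $\mathcal Q_j(c)$ is a lattice polytope of dimension $d$ whose vertices are exactly the points listed above, \[ b(\mathcal Q_j(c)) = cd+d+2+j,\qquad c(\mathcal Q_j(c)) = c,\qquad \mathrm{vol}(\mathcal Q_j(c)) = \frac{cd^2+jd+d-j}{d!}, \] and $\mathcal Q_j(c)$ is Castelnuovo whenever $c\ge 1$. -/

import Mathlib

open MeasureTheory
open scoped Nat

namespace LatticePolytope

/-- The lattice points of `ℝ^d`: the points all of whose coordinates are integers. -/
def latticePoints (d : ℕ) : Set (Fin d → ℝ) :=
  {x | ∀ k, ∃ n : ℤ, x k = n}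

/-- A lattice polytope: a convex polytope (the convex hull of finitely many points) each of whose
vertices (extreme points) is a lattice point. -/
def IsLatticePolytope {d : ℕ} (P : Set (Fin d → ℝ)) : Prop :=
  (∃ S : Set (Fin d → ℝ), S.Finite ∧ P = convexHull ℝ S) ∧
    P.extremePoints ℝ ⊆ latticePoints d

/-- The dimension of a convex set: that of its affine hull. -/
noncomputable def dim {d : ℕ} (P : Set (Fin d → ℝ)) : ℕ :=
  Module.finrank ℝ (vectorSpan ℝ P)

/-- The number of lattice points on the boundary of `P`. -/
noncomputable def numBoundary {d : ℕ} (P : Set (Fin d → ℝ)) : ℕ :=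
  (frontier P ∩ latticePoints d).ncard

/-- The number of lattice points in the interior of `P`. -/
noncomputable def numInterior {d : ℕ} (P : Set (Fin d → ℝ)) : ℕ :=
  (interior P ∩ latticePoints d).ncard

/-- The Lebesgue volume of `P`, as a real number. -/
noncomputable def vol {d : ℕ} (P : Set (Fin d → ℝ)) : ℝ :=
  volume.real P

/-- A Castelnuovo polytope: a lattice polytope of full dimension `d`, having an interior lattice
point, for which the lower bound `(d * c + (d - 1) * b - d ^ 2 + 2) / d!` on the volume, where
`b` and `c` count boundary and interior lattice points, is attained. -/
def IsCastelnuovo {d : ℕ} (P : Set (Fin d → ℝ)) : Prop :=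
  IsLatticePolytope P ∧ dim P = d ∧ 0 < numInterior P ∧
    vol P = ((d : ℝ) * numInterior P + ((d : ℝ) - 1) * numBoundary P - (d : ℝ) ^ 2 + 2) / d !

/-- The canonical unit coordinate vector `e_i` of `ℝ^d`, for `1 ≤ i ≤ d` (numbered from one). -/
def unitVec (d i : ℕ) : Fin d → ℝ :=
  fun k => if (k : ℕ) + 1 = i then 1 else 0

/-- The vector `w = - e_1 - ⋯ - e_{d-1}`. -/
def w (d : ℕ) : Fin d → ℝ :=
  -∑ i ∈ Finset.Icc 1 (d - 1), unitVec d i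

/-- The points `e_1, …, e_{d-1}, w`, `(c+1) e_d`, `e_i + (c+1) e_d` for `1 ≤ i ≤ j`,
`e_i + c e_d` for `j+1 ≤ i ≤ d-1`, and `w + c e_d`. -/
def prismTypeVertices (d j c : ℕ) : Set (Fin d → ℝ) :=
  unitVec d '' Set.Icc 1 (d - 1) ∪ {w d} ∪ {((c : ℝ) + 1) • unitVec d d} ∪
    (fun i => unitVec d i + ((c : ℝ) + 1) • unitVec d d) '' Set.Icc 1 j ∪
    (fun i => unitVec d i + (c : ℝ) • unitVec d d) '' Set.Icc (j + 1) (d - 1) ∪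
    {w d + (c : ℝ) • unitVec d d}

/-- The polytope `Q_j(c)` of prism type in `ℝ^d`. -/
def prismType (d j c : ℕ) : Set (Fin d → ℝ) :=
  convexHull ℝ (prismTypeVertices d j c)

end LatticePolytope

/-!
Write `d = n + 1`. The polytope `Q_j(c)` lies above the simplex in `ℝ^n` with vertices
`e_1, …, e_n, w`, whose barycenter is the origin. In terms of the barycentric coordinates
`b_0, …, b_n` of that simplex (`bary`), the polytope consists of the points above it with height
between `0` and the concave function `c + ∑_{i < j} b_i + (n + 1 - j) * min_k b_k`. Indeed, this
function interpolates the heights of the top vertices linearly on each of the `n + 1` simplices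
obtained by coning from the origin (`prismType_eq_prismRegion`). The remaining claims are read off
from this description.

* Each listed point is the only solution of the linear inequalities tight at it, hence is a vertex
  (`extremePoints_prismType`).
* Interior points satisfy all these inequalities strictly (`point_mem_interior_prismRegion`). The
  base simplex contains no lattice points but the origin and its vertices
  (`eq_zero_or_baseVertex`), so the lattice points of the polytope form one column above each of
  these, with the interior ones strictly inside the column of the origin.
* The volume is the integral of the height. An affine map with determinant `n + 1` carries the
  simplex spanned by the origin and the unit vectors to the base simplex (`lintegral_bary`). On the
  former, the integrals of `1`, of a barycentric coordinate and of the smallest one are `1 / n!`,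
  `1 / (n + 1)!` and `1 / ((n + 1) * (n + 1)!)`, the last two being volumes of simplices in
  `ℝ^(n+1)` (`volume_region_corner`).

The Castelnuovo property then is an identity between these numbers.
-/

namespace LatticePolytope

variable {n : ℕ}

/-! ### Coordinates adapted to the base simplex -/

/-- The barycentric coordinates of `x` with respect to `e_1, …, e_n, w` in `ℝ^n`, where
`w = -e_1 - ⋯ - e_n`. The coordinate belonging to `w` has index `Fin.last n`. -/
noncomputable def bary {n : ℕ} (x : Fin n → ℝ) : Fin (n + 1) → ℝ :=
  Fin.snoc (α := fun _ => ℝ) (fun k => x k + (1 - ∑ i, x i) / (n + 1)) ((1 - ∑ i, x i) / (n + 1))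

/-- The vertices `e_1, …, e_n, w` of the base simplex in `ℝ^n`, with `w` at index `Fin.last n`. -/
def baseVertex {n : ℕ} : Fin (n + 1) → (Fin n → ℝ) :=
  Fin.snoc (α := fun _ => Fin n → ℝ) (fun k => Pi.single k 1) (fun _ => -1)

/-- The point of `ℝ^(n+1)` at height `h` (its last coordinate) above the point `x` of `ℝ^n`. -/
def point {n : ℕ} (x : Fin n → ℝ) (h : ℝ) : Fin (n + 1) → ℝ :=
  Fin.snoc (α := fun _ => ℝ) x h

@[simp] lemma bary_castSucc (x : Fin n → ℝ) (k : Fin n) :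
    bary x k.castSucc = x k + (1 - ∑ i, x i) / (n + 1) := by simp [bary]

@[simp] lemma bary_last (x : Fin n → ℝ) :
    bary x (Fin.last n) = (1 - ∑ i, x i) / (n + 1) := by simp [bary]

@[simp] lemma baseVertex_castSucc (k : Fin n) :
    baseVertex k.castSucc = (Pi.single k 1 : Fin n → ℝ) := by simp [baseVertex]

@[simp] lemma baseVertex_last : baseVertex (Fin.last n) = (fun _ => -1) := by simp [baseVertex]

@[simp] lemma init_point (x : Fin n → ℝ) (h : ℝ) :
    Fin.init (α := fun _ => ℝ) (point x h) = x := by simp [point]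

@[simp] lemma point_castSucc (x : Fin n → ℝ) (h : ℝ) (k : Fin n) :
    point x h k.castSucc = x k := by simp [point]

@[simp] lemma point_last (x : Fin n → ℝ) (h : ℝ) : point x h (Fin.last n) = h := by simp [point]

lemma point_init_last (y : Fin (n + 1) → ℝ) :
    point (Fin.init (α := fun _ => ℝ) y) (y (Fin.last n)) = y := by simp [point]

lemma sum_smul_point {ι : Type*} (s : Finset ι) (a : ι → ℝ) (x : ι → Fin n → ℝ) (h : ι → ℝ) :
    ∑ i ∈ s, a i • point (x i) (h i) = point (∑ i ∈ s, a i • x i) (∑ i ∈ s, a i * h i) := by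
  ext k
  refine Fin.lastCases ?_ (fun k => ?_) k <;> simp [Finset.sum_apply]

lemma smul_point_add_smul_point (a b : ℝ) (x x' : Fin n → ℝ) (h h' : ℝ) :
    a • point x h + b • point x' h' = point (a • x + b • x') (a * h + b * h') := by
  ext k
  refine Fin.lastCases ?_ (fun k => ?_) k <;> simp

lemma sum_bary (x : Fin n → ℝ) : ∑ i, bary x i = 1 := by
  rw [Fin.sum_univ_castSucc]
  simp only [bary_castSucc, bary_last, Finset.sum_add_distrib, Finset.sum_const,
    Finset.card_univ, Fintype.card_fin, nsmul_eq_mul]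
  field_simp
  ring

lemma bary_combo (x x' : Fin n → ℝ) {a b : ℝ} (hab : a + b = 1) (i : Fin (n + 1)) :
    bary (a • x + b • x') i = a * bary x i + b * bary x' i := by
  obtain rfl : b = 1 - a := by linarith
  refine Fin.lastCases ?_ (fun k => ?_) i <;>
  · simp [Finset.sum_add_distrib, ← Finset.mul_sum]
    field_simp
    ring

lemma apply_eq_bary_sub (x : Fin n → ℝ) (k : Fin n) :
    x k = bary x k.castSucc - bary x (Fin.last n) := by simp

lemma bary_injective : Function.Injective (bary (n := n)) := by
  intro x x' h
  ext k
  rw [apply_eq_bary_sub x, apply_eq_bary_sub x', h]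

lemma bary_baseVertex (i k : Fin (n + 1)) :
    bary (baseVertex i) k = if k = i then 1 else 0 := by
  refine Fin.lastCases ?_ (fun i => ?_) i <;> refine Fin.lastCases ?_ (fun k => ?_) k
  · simp; field_simp; ring
  · simp [k.castSucc_ne_last]; field_simp; ring
  · simp [i.castSucc_ne_last.symm]
  · simp [Pi.single_apply]

@[simp] lemma bary_zero (i : Fin (n + 1)) : bary (0 : Fin n → ℝ) i = 1 / (n + 1) := by
  refine Fin.lastCases ?_ (fun k => ?_) i <;> simp

lemma sum_bary_smul_baseVertex (x : Fin n → ℝ) : ∑ i, bary x i • baseVertex i = x := by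
  ext k
  rw [Finset.sum_apply, Fin.sum_univ_castSucc]
  simp [Pi.single_apply]

lemma sum_baseVertex : ∑ i, baseVertex i = (0 : Fin n → ℝ) := by
  ext k
  rw [Finset.sum_apply, Fin.sum_univ_castSucc]
  simp [Pi.single_apply]

/-! ### Linear inequalities for the polytope -/

/-- The top vertex above the `i`-th vertex of the base simplex has height `c + extraHeight j i`.
Since `j ≤ n`, the vertex `w`, which has index `n`, has extra height zero. -/
def extraHeight (j : ℕ) (i : Fin (n + 1)) : ℕ := if (i : ℕ) < j then 1 else 0

/-- The affine function of `x` that bounds the height of the polytope of prism type above the part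
of the base simplex where the `k`-th barycentric coordinate is the smallest. Above the rest of the
base simplex its graph lies above the polytope. -/
noncomputable def roof (j c : ℕ) (x : Fin n → ℝ) (k : Fin (n + 1)) : ℝ :=
  c + ∑ i, extraHeight j i * bary x i + ((n : ℝ) + 1 - j) * bary x k

/-- The polytope of prism type, described by linear inequalities. -/
def prismRegion (n j c : ℕ) : Set (Fin (n + 1) → ℝ) :=
  {y | (∀ i, 0 ≤ bary (Fin.init (α := fun _ => ℝ) y) i) ∧ 0 ≤ y (Fin.last n) ∧
    ∀ k, y (Fin.last n) ≤ roof j c (Fin.init (α := fun _ => ℝ) y) k}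

lemma point_mem_prismRegion {j c : ℕ} {x : Fin n → ℝ} {h : ℝ} :
    point x h ∈ prismRegion n j c ↔ (∀ i, 0 ≤ bary x i) ∧ 0 ≤ h ∧ ∀ k, h ≤ roof j c x k := by
  simp [prismRegion]

lemma exists_point (y : Fin (n + 1) → ℝ) : ∃ x h, y = point x h :=
  ⟨_, _, (point_init_last y).symm⟩

lemma point_inj {x x' : Fin n → ℝ} {h h' : ℝ} : point x h = point x' h' ↔ x = x' ∧ h = h' := by
  refine ⟨fun e => ⟨?_, ?_⟩, fun e => by rw [e.1, e.2]⟩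
  · rw [← init_point x h, e, init_point]
  · rw [← point_last x h, e, point_last]

lemma roof_combo (j c : ℕ) (x x' : Fin n → ℝ) {a b : ℝ} (hab : a + b = 1) (k : Fin (n + 1)) :
    roof j c (a • x + b • x') k = a * roof j c x k + b * roof j c x' k := by
  have : ∑ i, (extraHeight j i : ℝ) * bary (a • x + b • x') i =
      a * ∑ i, extraHeight j i * bary x i + b * ∑ i, extraHeight j i * bary x' i := by
    rw [Finset.mul_sum, Finset.mul_sum, ← Finset.sum_add_distrib]
    exact Finset.sum_congr rfl fun i _ => by rw [bary_combo x x' hab]; ring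
  obtain rfl : b = 1 - a := by linarith
  rw [roof, this, bary_combo x x' hab, roof, roof]
  ring

lemma roof_baseVertex (j c : ℕ) (i k : Fin (n + 1)) :
    roof j c (baseVertex i) k = c + extraHeight j i + if k = i then (n : ℝ) + 1 - j else 0 := by
  simp [roof, bary_baseVertex]

lemma sum_extraHeight {j : ℕ} (hj : j ≤ n) : ∑ i : Fin (n + 1), extraHeight j i = j := by
  have := Fin.sum_univ_eq_sum_range (fun i => if i < j then 1 else 0) (n + 1)
  simp only [extraHeight, this, Finset.sum_boole, Nat.cast_id]
  rw [show (Finset.range (n + 1)).filter (· < j) = Finset.range j by ext; simp; omega]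
  simp

lemma roof_zero {j : ℕ} (c : ℕ) (hj : j ≤ n) (k : Fin (n + 1)) :
    roof j c (0 : Fin n → ℝ) k = c + 1 := by
  have : (∑ i : Fin (n + 1), (extraHeight j i : ℝ)) = j := by exact_mod_cast sum_extraHeight hj
  simp only [roof, bary_zero, ← Finset.sum_mul, this]
  field_simp
  ring

lemma convex_prismRegion (j c : ℕ) : Convex ℝ (prismRegion n j c) := by
  intro y hy y' hy' a b ha hb hab
  obtain ⟨x, h, rfl⟩ := exists_point y
  obtain ⟨x', h', rfl⟩ := exists_point y'
  rw [point_mem_prismRegion] at hy hy'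
  rw [smul_point_add_smul_point, point_mem_prismRegion]
  refine ⟨fun i => ?_, ?_, fun k => ?_⟩
  · rw [bary_combo x x' hab]
    have := hy.1 i; have := hy'.1 i; positivity
  · have := hy.2.1; have := hy'.2.1; positivity
  · rw [roof_combo j c x x' hab]
    have := hy.2.2 k; have := hy'.2.2 k; gcongr

/-- The vertices come in pairs above the vertices of the base simplex, except for the apex above
the origin. -/
lemma prismTypeVertices_eq {j : ℕ} (c : ℕ) (hj : j ≤ n) :
    prismTypeVertices (n + 1) j c =
      Set.range (fun i : Fin (n + 1) => point (baseVertex i) 0) ∪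
      Set.range (fun i : Fin (n + 1) => point (baseVertex i) (c + extraHeight j i)) ∪
      {point 0 (c + 1)} := by
  have hunit (k : Fin n) : unitVec (n + 1) (k + 1) = point (baseVertex k.castSucc) 0 := by
    ext l
    refine Fin.lastCases ?_ (fun l => ?_) l
    · simp [unitVec]; omega
    · simp [unitVec, Pi.single_apply, Fin.ext_iff]
  have hlast : unitVec (n + 1) (n + 1) = point 0 1 := by
    ext l
    refine Fin.lastCases ?_ (fun l => ?_) l
    · simp [unitVec]
    · simp [unitVec, l.2.ne]
  have hw : w (n + 1) = point (baseVertex (Fin.last n)) 0 := by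
    have : ∑ i ∈ Finset.Icc 1 n, unitVec (n + 1) i =
        ∑ k : Fin n, unitVec (n + 1) (k + 1) := by
      rw [Fin.sum_univ_eq_sum_range (fun i => unitVec (n + 1) (i + 1)) n,
        Finset.range_eq_Ico, Finset.sum_Ico_add' (fun i => unitVec (n + 1) i)]
      rfl
    rw [w, Nat.add_sub_cancel, this]
    simp only [hunit]
    ext l
    refine Fin.lastCases ?_ (fun l => ?_) l
    · simp [Finset.sum_apply]
    · simp [Finset.sum_apply, Pi.single_apply]
  have hadd (x : Fin n → ℝ) (t : ℝ) : point x 0 + point 0 t = point x t := by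
    ext l
    refine Fin.lastCases ?_ (fun l => ?_) l <;> simp
  have hsmul (t : ℝ) : t • point (0 : Fin n → ℝ) 1 = point 0 t := by
    ext l
    refine Fin.lastCases ?_ (fun l => ?_) l <;> simp
  have hex (i : ℕ) (h1 : 1 ≤ i) (h2 : i ≤ n) : ∃ k : Fin n, i = k + 1 :=
    ⟨⟨i - 1, by omega⟩, by simp; omega⟩
  simp only [prismTypeVertices, hlast, hw, hadd, hsmul, Nat.add_sub_cancel]
  apply Set.Subset.antisymm
  · rintro _ (((((⟨i, ⟨h1, h2⟩, rfl⟩ | rfl) | rfl) | ⟨i, ⟨h1, h2⟩, rfl⟩) |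
      ⟨i, ⟨h1, h2⟩, rfl⟩) | rfl)
    · obtain ⟨k, rfl⟩ := hex i h1 h2
      exact .inl (.inl ⟨k.castSucc, (hunit k).symm⟩)
    · exact .inl (.inl ⟨_, rfl⟩)
    · exact .inr rfl
    · obtain ⟨k, rfl⟩ := hex i h1 (h2.trans hj)
      refine .inl (.inr ⟨k.castSucc, ?_⟩)
      simp only [hunit, hadd]
      simp [extraHeight, Nat.lt_of_succ_le h2]
    · obtain ⟨k, rfl⟩ := hex i (by omega) h2
      refine .inl (.inr ⟨k.castSucc, ?_⟩)
      simp only [hunit, hadd]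
      simp [extraHeight, show ¬ (k : ℕ) < j by omega]
    · refine .inl (.inr ⟨Fin.last n, ?_⟩)
      simp [extraHeight, show ¬ n < j by omega]
  · rintro _ ((⟨i, rfl⟩ | ⟨i, rfl⟩) | rfl)
    · refine Fin.lastCases ?_ (fun k => ?_) i
      · simp
      · exact .inl (.inl (.inl (.inl (.inl ⟨k + 1, ⟨by omega, by omega⟩, hunit k⟩))))
    · refine Fin.lastCases ?_ (fun k => ?_) i
      · refine .inr ?_
        simp [extraHeight, show ¬ n < j by omega]
      · by_cases hk : (k : ℕ) < j
        · refine .inl (.inl (.inr ⟨k + 1, ⟨by omega, by omega⟩, ?_⟩))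
          simp only [hunit, hadd]
          simp [extraHeight, hk]
        · refine .inl (.inr ⟨k + 1, ⟨by omega, by omega⟩, ?_⟩)
          simp only [hunit, hadd]
          simp [extraHeight, hk]
    · exact .inl (.inl (.inl (.inr rfl)))

lemma prismTypeVertices_subset_prismRegion {j : ℕ} (c : ℕ) (hj : j ≤ n) :
    prismTypeVertices (n + 1) j c ⊆ prismRegion n j c := by
  have hj' : (j : ℝ) ≤ n := by exact_mod_cast hj
  have hbary (i k : Fin (n + 1)) : 0 ≤ bary (baseVertex i) k := by
    rw [bary_baseVertex]; split_ifs <;> simp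
  have hroof (i k : Fin (n + 1)) : (c : ℝ) + extraHeight j i ≤ roof j c (baseVertex i) k := by
    rw [roof_baseVertex]; split_ifs <;> linarith
  rw [prismTypeVertices_eq c hj]
  rintro _ ((⟨i, rfl⟩ | ⟨i, rfl⟩) | rfl)
  · exact point_mem_prismRegion.2 ⟨hbary i, le_rfl, fun k => le_trans (by positivity) (hroof i k)⟩
  · exact point_mem_prismRegion.2 ⟨hbary i, by positivity, hroof i⟩
  · exact point_mem_prismRegion.2
      ⟨fun i => by rw [bary_zero]; positivity, by positivity, fun k => (roof_zero c hj k).ge⟩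

lemma prismType_eq_prismRegion {j : ℕ} (c : ℕ) (hj : j ≤ n) :
    prismType (n + 1) j c = prismRegion n j c := by
  apply Set.Subset.antisymm
  · exact convexHull_min (prismTypeVertices_subset_prismRegion c hj) (convex_prismRegion j c)
  intro y hy
  obtain ⟨x, h, rfl⟩ := exists_point y
  obtain ⟨hb, h0, hr⟩ := point_mem_prismRegion.1 hy
  have hconv : Convex ℝ (prismType (n + 1) j c) := convex_convexHull ℝ _
  have hsub : prismTypeVertices (n + 1) j c ⊆ prismType (n + 1) j c := subset_convexHull ℝ _
  rw [prismTypeVertices_eq c hj] at hsub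
  have hbot : point x 0 ∈ prismType (n + 1) j c := by
    have := hconv.sum_mem (t := Finset.univ) (w := bary x)
      (z := fun i => point (baseVertex i) 0) (fun i _ => hb i) (sum_bary x)
      (fun i _ => hsub (.inl (.inl ⟨i, rfl⟩)))
    simpa [sum_smul_point, sum_bary_smul_baseVertex] using this
  -- Splitting off the multiple of `∑ i, baseVertex i = 0` allowed by the smallest coordinate turns
  -- the barycentric representation of `x` into one that uses the apex.
  obtain ⟨k, -, hk⟩ := Finset.exists_min_image Finset.univ (bary x) Finset.univ_nonempty
  have htop : point x (roof j c x k) ∈ prismType (n + 1) j c := by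
    have := hconv.sum_mem (t := Finset.univ)
      (w := fun o : Option (Fin (n + 1)) => o.elim (((n : ℝ) + 1) * bary x k)
        fun i => bary x i - bary x k)
      (z := fun o => o.elim (point 0 ((c : ℝ) + 1))
        fun i => point (baseVertex i) (c + extraHeight j i))
      (by
        rintro (_ | i) -
        · have := hb k
          simp only [Option.elim]; positivity
        · exact sub_nonneg.2 (hk i (Finset.mem_univ i)))
      (by simp [Fintype.sum_option, Finset.sum_sub_distrib, sum_bary])
      (by
        rintro (_ | i) -
        · exact hsub (.inr rfl)
        · exact hsub (.inl (.inr ⟨i, rfl⟩)))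
    rw [Fintype.sum_option] at this
    simp only [Option.elim, sum_smul_point] at this
    convert this using 1
    rw [← one_smul ℝ (point (∑ i, (bary x i - bary x k) • baseVertex i) _),
      smul_point_add_smul_point, point_inj]
    constructor
    · simp [sub_smul, Finset.sum_sub_distrib, sum_bary_smul_baseVertex, ← Finset.smul_sum,
        sum_baseVertex]
    · have h1 : ∑ i : Fin (n + 1), (extraHeight j i : ℝ) = j := by exact_mod_cast sum_extraHeight hj
      simp only [sub_mul, mul_add, Finset.sum_sub_distrib, Finset.sum_add_distrib,
        ← Finset.sum_mul, ← Finset.mul_sum, sum_bary, h1, roof]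
      simp [mul_comm (bary x _)]
      ring
  have hseg : point x h ∈ segment ℝ (point x 0) (point x (roof j c x k)) := by
    have hk0 : 0 ≤ roof j c x k := h0.trans (hr k)
    rcases hk0.eq_or_lt with hz | hpos
    · obtain rfl : h = 0 := le_antisymm (hz ▸ hr k) h0
      exact left_mem_segment ℝ _ _
    · refine ⟨1 - h / roof j c x k, h / roof j c x k, ?_, by positivity, by ring, ?_⟩
      · rw [sub_nonneg, div_le_one hpos]; exact hr k
      · rw [smul_point_add_smul_point, point_inj]
        refine ⟨by rw [← add_smul]; simp, by field_simp; ring⟩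
  exact hconv.segment_subset hbot htop hseg

/-! ### Vertices -/

lemma eq_baseVertex {x : Fin n → ℝ} {i : Fin (n + 1)} (h : ∀ k, k ≠ i → bary x k = 0) :
    x = baseVertex i := by
  apply bary_injective
  have hi : bary x i = 1 := by
    rw [← sum_bary x]
    exact (Finset.sum_eq_single i (fun k _ hk => h k hk) (by simp)).symm
  ext k
  rw [bary_baseVertex]
  split_ifs with hk
  · rw [hk, hi]
  · exact h k hk

lemma eq_zero_of_combo {a b p q : ℝ} (ha : 0 < a) (hb : 0 < b) (hp : 0 ≤ p) (hq : 0 ≤ q)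
    (h : a * p + b * q = 0) : p = 0 := by
  have h1 : a * p = 0 := by nlinarith [mul_nonneg ha.le hp, mul_nonneg hb.le hq]
  simpa [ha.ne'] using h1

/-- If one of the inequalities is tight at a proper convex combination of two points of the
polytope, then it is tight at both; those tight at a listed point have no other common solution. -/
lemma extremePoints_prismType {j : ℕ} (c : ℕ) (hn : 1 ≤ n) (hj : j ≤ n) :
    (prismType (n + 1) j c).extremePoints ℝ = prismTypeVertices (n + 1) j c := by
  apply Set.Subset.antisymm extremePoints_convexHull_subset
  intro v hv
  rw [mem_extremePoints_iff_left]
  refine ⟨subset_convexHull ℝ _ hv, ?_⟩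
  rw [show convexHull ℝ (prismTypeVertices (n + 1) j c) = prismRegion n j c from
    prismType_eq_prismRegion c hj]
  intro y hy y' hy' hseg
  obtain ⟨x, h, rfl⟩ := exists_point y
  obtain ⟨x', h', rfl⟩ := exists_point y'
  obtain ⟨a, b, ha, hb, hab, hv'⟩ := hseg
  rw [smul_point_add_smul_point] at hv'
  obtain ⟨hβ, h0, hr⟩ := point_mem_prismRegion.1 hy
  obtain ⟨hβ', h0', hr'⟩ := point_mem_prismRegion.1 hy'
  have : Nontrivial (Fin (n + 1)) := Fin.nontrivial_iff_two_le.2 (by omega)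
  have hbase (i : Fin (n + 1)) (hi : a • x + b • x' = baseVertex i) : x = baseVertex i := by
    refine eq_baseVertex fun k hk => eq_zero_of_combo ha hb (hβ k) (hβ' k) ?_
    rw [← bary_combo x x' hab, hi, bary_baseVertex, if_neg hk]
  have hroof (k : Fin (n + 1)) (hk : a * h + b * h' = roof j c (a • x + b • x') k) :
      h = roof j c x k := by
    rw [roof_combo j c x x' hab] at hk
    have := eq_zero_of_combo ha hb (sub_nonneg.2 (hr k)) (sub_nonneg.2 (hr' k)) (by linarith)
    linarith
  rw [prismTypeVertices_eq c hj] at hv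
  rcases hv with (⟨i, rfl⟩ | ⟨i, rfl⟩) | rfl
  · obtain ⟨hx, hh⟩ := point_inj.1 hv'
    exact point_inj.2 ⟨hbase i hx, eq_zero_of_combo ha hb h0 h0' hh⟩
  · obtain ⟨hx, hh⟩ := point_inj.1 hv'
    obtain ⟨k, hk⟩ := exists_ne i
    have hval := roof_baseVertex j c i k
    rw [if_neg hk, add_zero] at hval
    refine point_inj.2 ⟨hbase i hx, ?_⟩
    rw [hroof k (by rw [hx, hh, hval]), hbase i hx, hval]
  · obtain ⟨hx, hh⟩ := point_inj.1 hv'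
    have hall (k : Fin (n + 1)) : h = roof j c x k :=
      hroof k (by rw [hx, hh, roof_zero c hj])
    have hx0 : x = 0 := by
      have hj' : (j : ℝ) ≤ n := by exact_mod_cast hj
      have heq (k l : Fin (n + 1)) : bary x k = bary x l := by
        have hkl := (hall k).symm.trans (hall l)
        simp only [roof] at hkl
        exact mul_left_cancel₀ (show (n : ℝ) + 1 - j ≠ 0 by linarith) (by linarith)
      ext k
      rw [apply_eq_bary_sub x k, heq k.castSucc (Fin.last n), sub_self, Pi.zero_apply]
    exact point_inj.2 ⟨hx0, by rw [hall 0, hx0, roof_zero c hj]⟩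

/-! ### Interior and dimension -/

/-- An affine function that is nonnegative on a set and positive somewhere on it is positive on the
interior: otherwise moving a little further away from the positive value would make it negative. -/
lemma pos_of_mem_interior {E : Type*} [AddCommGroup E] [Module ℝ E] [TopologicalSpace E]
    [IsTopologicalAddGroup E] [ContinuousSMul ℝ E] {S : Set E} {f : E → ℝ}
    (hf : ∀ (a b : ℝ) (y z : E), a + b = 1 → f (a • y + b • z) = a * f y + b * f z)
    (hS : ∀ y ∈ S, 0 ≤ f y) {z : E} (hz : 0 < f z) {y : E} (hy : y ∈ interior S) : 0 < f y := by
  have hcont : Continuous fun t : ℝ => (1 + t) • y + (-t) • z := by fun_prop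
  have hev : ∀ᶠ t in nhdsWithin (0 : ℝ) (Set.Ioi 0), (1 + t) • y + (-t) • z ∈ S := by
    apply Filter.Eventually.filter_mono nhdsWithin_le_nhds
    exact hcont.continuousAt.eventually_mem (by simpa using mem_interior_iff_mem_nhds.1 hy)
  obtain ⟨t, ht, htpos⟩ := (hev.and self_mem_nhdsWithin).exists
  have h1 := hS _ ht
  rw [hf _ _ _ _ (by ring)] at h1
  have htpos : 0 < t := htpos
  have := mul_pos htpos hz
  by_contra hneg
  push Not at hneg
  nlinarith

lemma continuous_bary (i : Fin (n + 1)) : Continuous fun x : Fin n → ℝ => bary x i := by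
  refine Fin.lastCases ?_ (fun k => ?_) i
  · simp only [bary_last]; fun_prop
  · simp only [bary_castSucc]; fun_prop

lemma continuous_roof (j c : ℕ) (k : Fin (n + 1)) :
    Continuous fun x : Fin n → ℝ => roof j c x k := by
  have := continuous_bary (n := n)
  unfold roof
  fun_prop

lemma continuous_init : Continuous (Fin.init (α := fun _ : Fin (n + 1) => ℝ)) :=
  continuous_pi fun _ => continuous_apply _

lemma point_mem_interior_prismRegion {j c : ℕ} (hj : j ≤ n) {x : Fin n → ℝ} {h : ℝ} :
    point x h ∈ interior (prismRegion n j c) ↔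
      (∀ i, 0 < bary x i) ∧ 0 < h ∧ ∀ k, h < roof j c x k := by
  constructor
  · intro hy
    refine ⟨fun i => ?_, ?_, fun k => ?_⟩
    · simpa using pos_of_mem_interior
        (f := fun y : Fin (n + 1) → ℝ => bary (Fin.init (α := fun _ => ℝ) y) i)
        (z := point (baseVertex i) 0) (fun a b y z hab => bary_combo _ _ hab i)
        (fun y hy => hy.1 i) (by simp [bary_baseVertex]) hy
    · simpa using pos_of_mem_interior (f := fun y : Fin (n + 1) → ℝ => y (Fin.last n))
        (z := point 0 1) (fun a b y z hab => by simp) (fun y hy => hy.2.1) (by simp) hy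
    · have := pos_of_mem_interior
        (f := fun y : Fin (n + 1) → ℝ =>
          roof j c (Fin.init (α := fun _ => ℝ) y) k - y (Fin.last n))
        (z := point 0 0)
        (fun a b y z hab => by
          rw [show Fin.init (α := fun _ => ℝ) (a • y + b • z) =
            a • Fin.init (α := fun _ => ℝ) y + b • Fin.init (α := fun _ => ℝ) z from rfl,
            roof_combo _ _ _ _ hab]
          simp only [Pi.add_apply, Pi.smul_apply, smul_eq_mul]
          ring)
        (fun y hy => sub_nonneg.2 (hy.2.2 k))
        (by simp only [init_point, point_last, roof_zero c hj, sub_zero]; positivity) hy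
      simpa using this
  · rintro ⟨h1, h2, h3⟩
    have hopen : IsOpen {y : Fin (n + 1) → ℝ |
        (∀ i, 0 < bary (Fin.init (α := fun _ => ℝ) y) i) ∧ 0 < y (Fin.last n) ∧
        ∀ k, y (Fin.last n) < roof j c (Fin.init (α := fun _ => ℝ) y) k} := by
      simp only [Set.ofPred_and, Set.ofPred_forall]
      refine .inter (isOpen_iInter_of_finite fun i => ?_) (.inter ?_
        (isOpen_iInter_of_finite fun k => ?_))
      · exact isOpen_lt continuous_const ((continuous_bary i).comp continuous_init)
      · exact isOpen_lt continuous_const (continuous_apply _)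
      · exact isOpen_lt (continuous_apply _) ((continuous_roof j c k).comp continuous_init)
    refine interior_maximal (fun y hy => ?_) hopen (a := point x h) (by simpa using ⟨h1, h2, h3⟩)
    exact ⟨fun i => (hy.1 i).le, hy.2.1.le, fun k => (hy.2.2 k).le⟩

lemma dim_prismType {j : ℕ} (c : ℕ) (hj : j ≤ n) : dim (prismType (n + 1) j c) = n + 1 := by
  have hne : (interior (prismType (n + 1) j c)).Nonempty := by
    rw [prismType_eq_prismRegion c hj]
    -- This point is interior also for `c = 0`, when there is no interior lattice point.
    refine ⟨point 0 (1 / 2), (point_mem_interior_prismRegion hj).2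
      ⟨fun i => by rw [bary_zero]; positivity, by norm_num, fun k => ?_⟩⟩
    rw [roof_zero c hj]
    have : (0 : ℝ) ≤ c := by positivity
    linarith
  have hspan := affineSpan_eq_top_of_nonempty_interior
    (s := prismType (n + 1) j c) (hne.mono (interior_mono (subset_convexHull ℝ _)))
  rw [dim, ← direction_affineSpan, hspan, AffineSubspace.direction_top, finrank_top]
  simp

/-! ### Lattice points -/

lemma point_mem_latticePoints {x : Fin n → ℝ} {h : ℝ} :
    point x h ∈ latticePoints (n + 1) ↔ x ∈ latticePoints n ∧ ∃ m : ℤ, h = m := by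
  simp [latticePoints, Fin.forall_fin_succ']

lemma baseVertex_mem_latticePoints (i : Fin (n + 1)) :
    (baseVertex i : Fin n → ℝ) ∈ latticePoints n := by
  intro k
  refine Fin.lastCases ⟨-1, by simp⟩ (fun i => ?_) i
  by_cases h : k = i
  · exact ⟨1, by simp [h]⟩
  · exact ⟨0, by simp [h]⟩

/-- The base simplex has no lattice points besides the origin and its vertices. -/
lemma eq_zero_or_baseVertex {x : Fin n → ℝ} (hx : x ∈ latticePoints n)
    (hb : ∀ i, 0 ≤ bary x i) : x = 0 ∨ ∃ i, x = baseVertex i := by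
  -- With `s = 1 - ∑ i, z i`, the barycentric coordinates multiplied by `n + 1` are the integers
  -- `z k * (n + 1) + s` and `s`: nonnegative, congruent modulo `n + 1`, and of sum `n + 1`.
  choose z hz using hx
  have hsum : ∑ i, x i = ((∑ i, z i : ℤ) : ℝ) := by simp [hz]
  have hn : (0 : ℝ) < n + 1 := by positivity
  have hlast : 0 ≤ 1 - ∑ i, z i := by
    have := hb (Fin.last n)
    rw [bary_last, hsum, le_div_iff₀ hn, zero_mul] at this
    exact_mod_cast this
  have hk (k : Fin n) : 0 ≤ z k * (n + 1) + (1 - ∑ i, z i) := by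
    have := hb k.castSucc
    rw [bary_castSucc, hsum, hz, ← mul_le_mul_iff_left₀ hn, zero_mul, add_mul,
      div_mul_cancel₀ _ hn.ne'] at this
    exact_mod_cast this
  set s : ℤ := 1 - ∑ i, z i with hs
  have htot : ∑ k, (z k * (n + 1) + s) + s = n + 1 := by
    simp only [Finset.sum_add_distrib, ← Finset.sum_mul, Finset.sum_const, Finset.card_univ,
      Fintype.card_fin, nsmul_eq_mul]
    rw [show ∑ i, z i = 1 - s by omega]
    ring
  have hsle : s ≤ n + 1 := by
    have := Finset.sum_nonneg fun k (_ : k ∈ Finset.univ) => hk k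
    omega
  rcases hlast.eq_or_lt with h0 | hpos
  · -- The coordinate of `w` vanishes, so the `z k` are nonnegative with sum one.
    right
    have hznn (k : Fin n) : 0 ≤ z k := by
      have := hk k
      rw [← h0, add_zero] at this
      exact nonneg_of_mul_nonneg_left this (by positivity)
    have h1 : ∑ i, z i = 1 := by omega
    obtain ⟨i, -, hi⟩ : ∃ i ∈ Finset.univ, z i ≠ 0 := by
      by_contra! hall
      rw [Finset.sum_eq_zero hall] at h1
      omega
    refine ⟨i.castSucc, ?_⟩
    have hrest := Finset.add_sum_erase Finset.univ z (Finset.mem_univ i)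
    have hnn := Finset.sum_nonneg fun k (_ : k ∈ Finset.univ.erase i) => hznn k
    have hi1 : z i = 1 := by have := hznn i; omega
    have hz0 := (Finset.sum_eq_zero_iff_of_nonneg fun k _ => hznn k).1
      (show ∑ k ∈ Finset.univ.erase i, z k = 0 by omega)
    ext k
    rw [hz, baseVertex_castSucc, Pi.single_apply]
    split_ifs with hki
    · rw [hki, hi1, Int.cast_one]
    · rw [hz0 k (by simp [hki]), Int.cast_zero]
  rcases hsle.eq_or_lt with htop | hlt
  · -- The coordinate of `w` is one, so all the others vanish.
    right
    refine ⟨Fin.last n, ?_⟩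
    have h0 := (Finset.sum_eq_zero_iff_of_nonneg fun k _ => hk k).1
      (show ∑ k, (z k * (n + 1) + s) = 0 by omega)
    ext k
    have h1 := h0 k (Finset.mem_univ k)
    rw [htop] at h1
    have : (z k + 1) * ((n : ℤ) + 1) = 0 := by linarith
    rcases mul_eq_zero.1 this with h2 | h2
    · rw [hz, baseVertex_last, show z k = -1 by omega]; simp
    · omega
  · -- Here `0 < s < n + 1`, which forces `0 ≤ z k` for all `k`, while the sum is at most zero.
    left
    have hznn (k : Fin n) : 0 ≤ z k := by
      have := hk k
      by_contra! hneg
      nlinarith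
    have hz0 := (Finset.sum_eq_zero_iff_of_nonneg fun k _ => hznn k).1
      (le_antisymm (show ∑ k, z k ≤ 0 by omega) (Finset.sum_nonneg fun k _ => hznn k))
    ext k
    rw [hz, hz0 k (Finset.mem_univ k)]; simp

/-- The lattice points of the base simplex: the origin and the vertices. -/
def columnBase : Option (Fin (n + 1)) → (Fin n → ℝ)
  | none => 0
  | some i => baseVertex i

/-- The height of the highest point of the polytope above a lattice point of the base simplex. -/
def columnHeight (n j c : ℕ) : Option (Fin (n + 1)) → ℕ
  | none => c + 1
  | some i => c + extraHeight j i

lemma columnBase_injective (hn : 1 ≤ n) : Function.Injective (columnBase (n := n)) := by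
  have hne (i : Fin (n + 1)) : baseVertex i ≠ (0 : Fin n → ℝ) := by
    intro h
    have h1 := bary_baseVertex i i
    rw [h, bary_zero, if_pos rfl, div_eq_one_iff_eq (by positivity)] at h1
    have : (1 : ℝ) ≤ n := by exact_mod_cast hn
    linarith
  rintro (_ | i) (_ | i') h
  · rfl
  · exact (hne i' h.symm).elim
  · exact (hne i h).elim
  · have h1 := bary_baseVertex i' i
    rw [← show baseVertex i = baseVertex i' from h, bary_baseVertex, if_pos rfl] at h1
    by_contra hii
    rw [if_neg (by simpa using hii)] at h1
    exact one_ne_zero h1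

/-- Indices for the lattice points of the polytope: a lattice point of the base simplex, and a
height. -/
def columnPoints (n j c : ℕ) : Finset (Σ _ : Option (Fin (n + 1)), ℕ) :=
  Finset.univ.sigma fun o => Finset.range (columnHeight n j c o + 1)

lemma prismRegion_inter_latticePoints {j : ℕ} (c : ℕ) (hn : 1 ≤ n) (hj : j ≤ n) :
    prismRegion n j c ∩ latticePoints (n + 1) =
      (fun p : Σ _ : Option (Fin (n + 1)), ℕ => point (columnBase p.1) p.2) ''
        columnPoints n j c := by
  have : Nontrivial (Fin (n + 1)) := Fin.nontrivial_iff_two_le.2 (by omega)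
  have hj' : (j : ℝ) ≤ n := by exact_mod_cast hj
  have hcol (o : Option (Fin (n + 1))) (m : ℕ) : point (columnBase o) m ∈ prismRegion n j c ↔
      m ≤ columnHeight n j c o := by
    rw [point_mem_prismRegion, and_iff_right, and_iff_right (by positivity)]
    · rcases o with _ | i
      · simp only [columnBase, roof_zero c hj, columnHeight, forall_const]
        exact_mod_cast Iff.rfl
      · simp only [columnBase, roof_baseVertex, columnHeight]
        constructor
        · intro h
          obtain ⟨k, hk⟩ := exists_ne i
          have := h k
          rw [if_neg hk, add_zero] at this
          exact_mod_cast this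
        · intro h k
          have : (m : ℝ) ≤ c + extraHeight j i := by exact_mod_cast h
          split_ifs <;> linarith
    · intro i
      rcases o with _ | i'
      · simp only [columnBase, bary_zero]; positivity
      · simp only [columnBase, bary_baseVertex]; split_ifs <;> simp
  ext y
  simp only [Set.mem_inter_iff, Set.mem_image, Finset.mem_coe, columnPoints, Finset.mem_sigma,
    Finset.mem_univ, true_and, Finset.mem_range, Nat.lt_succ_iff, Sigma.exists]
  constructor
  · rintro ⟨hy, hl⟩
    obtain ⟨x, h, rfl⟩ := exists_point y
    obtain ⟨hx, m, rfl⟩ := point_mem_latticePoints.1 hl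
    have hmem := point_mem_prismRegion.1 hy
    obtain ⟨m, rfl⟩ := Int.eq_ofNat_of_zero_le (show 0 ≤ m by exact_mod_cast hmem.2.1)
    obtain ⟨o, rfl⟩ : ∃ o, x = columnBase o := by
      rcases eq_zero_or_baseVertex hx hmem.1 with h | ⟨i, h⟩
      exacts [⟨none, h⟩, ⟨some i, h⟩]
    exact ⟨o, m, (hcol o m).1 (by simpa using hy), by simp⟩
  · rintro ⟨o, m, hm, rfl⟩
    refine ⟨(hcol o m).2 hm, point_mem_latticePoints.2 ⟨?_, m, by simp⟩⟩
    rcases o with _ | i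
    · exact fun k => ⟨0, by simp [columnBase]⟩
    · exact baseVertex_mem_latticePoints i

lemma card_columnPoints {j : ℕ} (c : ℕ) (hj : j ≤ n) :
    (columnPoints n j c).card = c + 2 + ((n + 1) * (c + 1) + j) := by
  simp only [columnPoints, Finset.card_sigma, Finset.card_range, Fintype.sum_option, columnHeight]
  have : ∑ i : Fin (n + 1), (c + extraHeight j i + 1) = (n + 1) * (c + 1) + j := by
    have := sum_extraHeight hj
    simp only [Finset.sum_add_distrib, this]
    simp
    ring
  omega

lemma injective_columnPoint (hn : 1 ≤ n) : Function.Injective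
    (fun p : Σ _ : Option (Fin (n + 1)), ℕ => point (columnBase p.1) p.2) := by
  rintro ⟨o, m⟩ ⟨o', m'⟩ h
  obtain ⟨h1, h2⟩ := point_inj.1 h
  obtain rfl := columnBase_injective hn h1
  obtain rfl : m = m' := by exact_mod_cast h2
  rfl

lemma ncard_prismRegion_inter_latticePoints {j : ℕ} (c : ℕ) (hn : 1 ≤ n) (hj : j ≤ n) :
    (prismRegion n j c ∩ latticePoints (n + 1)).ncard = c + 2 + ((n + 1) * (c + 1) + j) := by
  rw [prismRegion_inter_latticePoints c hn hj,
    Set.ncard_image_of_injective _ (injective_columnPoint hn), Set.ncard_coe_finset,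
    card_columnPoints c hj]

lemma numInterior_prismType {j : ℕ} (c : ℕ) (hn : 1 ≤ n) (hj : j ≤ n) :
    numInterior (prismType (n + 1) j c) = c := by
  have : Nontrivial (Fin (n + 1)) := Fin.nontrivial_iff_two_le.2 (by omega)
  have key : interior (prismRegion n j c) ∩ latticePoints (n + 1) =
      (fun m : ℕ => point (0 : Fin n → ℝ) ((m : ℝ) + 1)) '' (Finset.range c : Finset ℕ) := by
    ext y
    constructor
    · rintro ⟨hy, hl⟩
      have hmem : y ∈ prismRegion n j c ∩ latticePoints (n + 1) := ⟨interior_subset hy, hl⟩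
      rw [prismRegion_inter_latticePoints c hn hj] at hmem
      obtain ⟨⟨o, m⟩, -, rfl⟩ := hmem
      obtain ⟨h1, h2, h3⟩ := (point_mem_interior_prismRegion hj).1 hy
      rcases o with _ | i
      · have h3 := h3 0
        simp only [columnBase, roof_zero c hj] at h2 h3
        norm_cast at h2 h3
        refine ⟨m - 1, by simp; omega, ?_⟩
        simp [columnBase, Nat.cast_sub h2]
      · obtain ⟨k, hk⟩ := exists_ne i
        have := h1 k
        simp [columnBase, bary_baseVertex, hk] at this
    · rintro ⟨m, hm, rfl⟩
      have hm : m < c := by simpa using hm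
      have hm' : (m : ℝ) < c := by exact_mod_cast hm
      refine ⟨(point_mem_interior_prismRegion hj).2 ⟨fun i => by rw [bary_zero]; positivity,
        by positivity, fun k => by rw [roof_zero c hj]; linarith⟩, point_mem_latticePoints.2
        ⟨fun k => ⟨0, by simp⟩, m + 1, by simp⟩⟩
  rw [numInterior, prismType_eq_prismRegion c hj, key, Set.ncard_image_of_injective,
    Set.ncard_coe_finset, Finset.card_range]
  intro m m' h
  simpa using (point_inj.1 h).2

lemma finite_prismTypeVertices (d j c : ℕ) : (prismTypeVertices d j c).Finite := by
  unfold prismTypeVertices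
  have h (a b : ℕ) := Set.finite_Icc a b
  refine .union (.union (.union (.union (.union ?_ ?_) ?_) ?_) ?_) ?_ <;>
    first | exact Set.finite_singleton _ | exact (h _ _).image _

lemma numBoundary_prismType {j : ℕ} (c : ℕ) (hn : 1 ≤ n) (hj : j ≤ n) :
    numBoundary (prismType (n + 1) j c) = c * (n + 1) + (n + 1) + 2 + j := by
  have hclosed : IsClosed (prismType (n + 1) j c) :=
    (finite_prismTypeVertices _ _ _).isClosed_convexHull ℝ
  have hint := numInterior_prismType c hn hj
  have htot := ncard_prismRegion_inter_latticePoints c hn hj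
  have hfin : (prismRegion n j c ∩ latticePoints (n + 1)).Finite := by
    rw [prismRegion_inter_latticePoints c hn hj]
    exact (Finset.finite_toSet _).image _
  rw [← prismType_eq_prismRegion c hj] at htot hfin
  rw [numInterior] at hint
  have hsub : interior (prismType (n + 1) j c) ∩ latticePoints (n + 1) ⊆
      prismType (n + 1) j c ∩ latticePoints (n + 1) :=
    Set.inter_subset_inter_left _ interior_subset
  have hsplit : frontier (prismType (n + 1) j c) ∩ latticePoints (n + 1) =
      (prismType (n + 1) j c ∩ latticePoints (n + 1)) \
        (interior (prismType (n + 1) j c) ∩ latticePoints (n + 1)) := by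
    rw [hclosed.frontier_eq]
    ext; simp only [Set.mem_inter_iff, Set.mem_sdiff]; tauto
  have := Set.ncard_sdiff_add_ncard_of_subset hsub hfin
  rw [← hsplit, hint, htot] at this
  rw [numBoundary]
  linarith

lemma isLatticePolytope_prismType {j : ℕ} (c : ℕ) (hj : j ≤ n) :
    IsLatticePolytope (prismType (n + 1) j c) := by
  refine ⟨⟨_, finite_prismTypeVertices _ _ _, rfl⟩,
    extremePoints_convexHull_subset.trans ?_⟩
  rw [prismTypeVertices_eq c hj]
  rintro _ ((⟨i, rfl⟩ | ⟨i, rfl⟩) | rfl)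
  · exact point_mem_latticePoints.2 ⟨baseVertex_mem_latticePoints i, 0, by simp⟩
  · exact point_mem_latticePoints.2 ⟨baseVertex_mem_latticePoints i, c + extraHeight j i, by simp⟩
  · exact point_mem_latticePoints.2 ⟨fun k => ⟨0, by simp⟩, c + 1, by simp⟩

/-! ### Integrals over the standard simplex -/

/-- The barycentric coordinates of `l` with respect to `e_1, …, e_n, 0` in `ℝ^n`, the coordinate
belonging to the origin having index `Fin.last n`. -/
def corner (l : Fin n → ℝ) : Fin (n + 1) → ℝ :=
  Fin.snoc (α := fun _ => ℝ) l (1 - ∑ i, l i)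

@[simp] lemma corner_castSucc (l : Fin n → ℝ) (k : Fin n) : corner l k.castSucc = l k := by
  simp [corner]

@[simp] lemma corner_last (l : Fin n → ℝ) : corner l (Fin.last n) = 1 - ∑ i, l i := by
  simp [corner]

lemma continuous_corner (i : Fin (n + 1)) : Continuous fun l : Fin n → ℝ => corner l i := by
  refine Fin.lastCases ?_ (fun k => ?_) i
  · simp only [corner_last]; fun_prop
  · simp only [corner_castSucc]; fun_prop

/-- The simplex with vertices `0, e_1, …, e_n` in `ℝ^n`. -/
def cornerSimplex (n : ℕ) : Set (Fin n → ℝ) := {l | ∀ i, 0 ≤ corner l i}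

lemma isClosed_cornerSimplex : IsClosed (cornerSimplex n) := by
  simp only [cornerSimplex, Set.ofPred_forall]
  exact isClosed_iInter fun i => isClosed_le continuous_const (continuous_corner i)

/-- Lower bounds `h * v i` on the barycentric coordinates cut out a translate of the simplex scaled
by `1 - (∑ i, v i) * h`. -/
lemma volume_corner_ge (v : Fin (n + 1) → ℝ) {h : ℝ} (hh : 0 < 1 - (∑ i, v i) * h) :
    volume {l : Fin n → ℝ | ∀ i, h * v i ≤ corner l i} =
      ENNReal.ofReal ((1 - (∑ i, v i) * h) ^ n) * volume (cornerSimplex n) := by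
  set r := 1 - (∑ i, v i) * h with hr
  have key : {l : Fin n → ℝ | ∀ i, h * v i ≤ corner l i} =
      (fun l => l - fun k => h * v k.castSucc) ⁻¹' ((r⁻¹ • ·) ⁻¹' cornerSimplex n) := by
    ext l
    simp only [Set.mem_preimage, cornerSimplex, Set.mem_ofPred_eq]
    refine forall_congr' fun i => ?_
    have : corner (r⁻¹ • (l - fun k => h * v k.castSucc)) i = r⁻¹ * (corner l i - h * v i) := by
      refine Fin.lastCases ?_ (fun k => ?_) i
      · simp only [corner_last, Pi.smul_apply, Pi.sub_apply, smul_eq_mul, ← Finset.mul_sum,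
          Finset.sum_sub_distrib]
        rw [Fin.sum_univ_castSucc] at hr
        field_simp
        rw [hr]
        ring
      · simp
    rw [this, mul_nonneg_iff_of_pos_left (by positivity), sub_nonneg]
  simp only [key, sub_eq_add_neg, measure_preimage_add_right]
  rw [Measure.addHaar_preimage_smul _ (by positivity)]
  congr 2
  rw [Module.finrank_fintype_fun_eq_card, Fintype.card_fin, inv_pow, inv_inv]
  exact abs_of_pos (by positivity)

lemma lintegral_one_sub_mul_pow {a : ℝ} (ha : 0 < a) (n : ℕ) :
    ∫⁻ h in Set.Ioo 0 a⁻¹, ENNReal.ofReal ((1 - a * h) ^ n) =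
      ENNReal.ofReal (1 / (a * (n + 1))) := by
  have hint : IntegrableOn (fun h : ℝ => (1 - a * h) ^ n) (Set.Ioo 0 a⁻¹) :=
    (Continuous.integrableOn_Icc (by fun_prop)).mono_set Set.Ioo_subset_Icc_self
  rw [← ofReal_integral_eq_lintegral_ofReal hint]
  · rw [← integral_Ioc_eq_integral_Ioo, ← intervalIntegral.integral_of_le (by positivity),
      intervalIntegral.integral_comp_sub_mul (fun x => x ^ n) ha.ne' 1, integral_pow]
    congr 1
    simp [ha.ne', mul_comm]
  · refine (ae_restrict_iff' measurableSet_Ioo).2 (.of_forall fun h hh => ?_)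
    have : a * h < 1 := by
      have := mul_lt_mul_of_pos_left hh.2 ha
      rwa [mul_inv_cancel₀ ha.ne'] at this
    have : 0 ≤ 1 - a * h := by linarith
    simp only [Pi.zero_apply]
    positivity

/-- The volume of a simplex one dimension higher, with slices that shrink linearly. Different `v`
give the volume of `cornerSimplex (n + 1)` and the integrals over `cornerSimplex n` of a barycentric
coordinate and of the smallest one. -/
lemma volume_region_corner (v : Fin (n + 1) → ℝ) (ha : 0 < ∑ i, v i) :
    (volume : Measure (ℝ × (Fin n → ℝ))) {p | 0 ≤ p.1 ∧ ∀ i, p.1 * v i ≤ corner p.2 i} =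
      ENNReal.ofReal (1 / ((∑ i, v i) * (n + 1))) * volume (cornerSimplex n) := by
  set a := ∑ i, v i with hadef
  have hmeas : MeasurableSet
      {p : ℝ × (Fin n → ℝ) | 0 ≤ p.1 ∧ ∀ i, p.1 * v i ≤ corner p.2 i} := by
    apply IsClosed.measurableSet
    simp only [Set.ofPred_and, Set.ofPred_forall]
    refine (isClosed_le continuous_const continuous_fst).inter (isClosed_iInter fun i => ?_)
    exact isClosed_le (by fun_prop) ((continuous_corner i).comp continuous_snd)
  rw [Measure.volume_eq_prod, Measure.prod_apply hmeas]
  have hsum (l : Fin n → ℝ) : ∑ i, corner l i = 1 := by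
    rw [Fin.sum_univ_castSucc]; simp
  have hslice : ∀ᵐ h : ℝ, volume (Prod.mk h ⁻¹'
        {p : ℝ × (Fin n → ℝ) | 0 ≤ p.1 ∧ ∀ i, p.1 * v i ≤ corner p.2 i}) =
      (Set.Ioo 0 a⁻¹).indicator
        (fun h => ENNReal.ofReal ((1 - a * h) ^ n) * volume (cornerSimplex n)) h := by
    -- The two end points of the range of `h` are dropped, so that only slices scaled by a positive
    -- factor occur.
    filter_upwards [Measure.ae_ne volume 0, Measure.ae_ne volume a⁻¹] with h h0 ha'
    by_cases hh : h ∈ Set.Ioo 0 a⁻¹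
    · rw [Set.indicator_of_mem hh, ← volume_corner_ge v]
      · simp [Set.preimage, hh.1.le]
      · have := mul_lt_mul_of_pos_left hh.2 ha
        rw [mul_inv_cancel₀ ha.ne'] at this
        linarith
    · rw [Set.indicator_of_notMem hh]
      convert measure_empty (μ := (volume : Measure (Fin n → ℝ)))
      ext l
      simp only [Set.mem_preimage, Set.mem_ofPred_eq, Set.mem_empty_iff_false, iff_false]
      rintro ⟨h1, h2⟩
      apply hh
      refine ⟨lt_of_le_of_ne h1 (Ne.symm h0), lt_of_le_of_ne ?_ ha'⟩
      have := Finset.sum_le_sum fun i (_ : i ∈ Finset.univ) => h2 i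
      rw [← Finset.mul_sum, hsum] at this
      rwa [← one_div, le_div_iff₀ ha]
  rw [lintegral_congr_ae hslice, lintegral_indicator measurableSet_Ioo,
    lintegral_mul_const _ (by fun_prop), lintegral_one_sub_mul_pow ha]

lemma volume_cornerSimplex (n : ℕ) :
    volume (cornerSimplex n) = ENNReal.ofReal (1 / n !) := by
  induction n with
  | zero =>
    rw [show cornerSimplex 0 = Set.univ by
      ext l; simp [cornerSimplex, corner, Fin.snoc]]
    simp [volume_pi]
  | succ n ih =>
    have hpre : cornerSimplex (n + 1) =
        MeasurableEquiv.piFinSuccAbove (fun _ => ℝ) (Fin.last n) ⁻¹'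
          {p | 0 ≤ p.1 ∧ ∀ i, p.1 * (Pi.single (Fin.last n) 1 : Fin (n + 1) → ℝ) i ≤
            corner p.2 i} := by
      ext l
      simp only [cornerSimplex, Set.mem_preimage, Set.mem_ofPred_eq,
        MeasurableEquiv.piFinSuccAbove_apply, Fin.insertNthEquiv_symm_apply]
      rw [Fin.forall_fin_succ', Fin.forall_fin_succ', Fin.forall_fin_succ']
      simp only [corner_castSucc, corner_last, Fin.sum_univ_castSucc (n := n), Fin.removeNth,
        Fin.succAbove_last]
      simp
      rw [and_comm (a := ∀ i : Fin n, _), and_assoc, le_sub_iff_add_le, add_comm]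
    have hmp := volume_preserving_piFinSuccAbove (fun _ : Fin (n + 1) => ℝ) (Fin.last n)
    rw [hpre, hmp.measure_preimage_equiv, volume_region_corner _ (by simp), ih,
      ← ENNReal.ofReal_mul (by simp; positivity)]
    congr 1
    rw [Nat.factorial_succ]
    simp
    field_simp

/-- The volume between `S` and the graph of `f`. Where `f` is negative the region is empty, and
`ENNReal.ofReal` is zero. -/
lemma volume_region_eq_lintegral {S : Set (Fin n → ℝ)} (hS : MeasurableSet S)
    {f : (Fin n → ℝ) → ℝ} (hf : Measurable f) :
    (volume : Measure (ℝ × (Fin n → ℝ))) {p | p.2 ∈ S ∧ 0 ≤ p.1 ∧ p.1 ≤ f p.2} =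
      ∫⁻ x in S, ENNReal.ofReal (f x) := by
  have hmeas : MeasurableSet {p : ℝ × (Fin n → ℝ) | p.2 ∈ S ∧ 0 ≤ p.1 ∧ p.1 ≤ f p.2} :=
    (measurable_snd hS).inter ((measurableSet_le measurable_const measurable_fst).inter
      (measurableSet_le measurable_fst (hf.comp measurable_snd)))
  rw [Measure.volume_eq_prod, Measure.prod_apply_symm hmeas, ← lintegral_indicator hS]
  refine lintegral_congr fun x => ?_
  by_cases hx : x ∈ S
  · rw [Set.indicator_of_mem hx, show (fun h => (h, x)) ⁻¹'
      {p : ℝ × (Fin n → ℝ) | p.2 ∈ S ∧ 0 ≤ p.1 ∧ p.1 ≤ f p.2} = Set.Icc 0 (f x) by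
        ext h; simp [hx], Real.volume_Icc, sub_zero]
  · rw [Set.indicator_of_notMem hx, show (fun h => (h, x)) ⁻¹'
      {p : ℝ × (Fin n → ℝ) | p.2 ∈ S ∧ 0 ≤ p.1 ∧ p.1 ≤ f p.2} = ∅ by
        ext h; simp [hx], measure_empty]

lemma lintegral_corner (i : Fin (n + 1)) :
    ∫⁻ l in cornerSimplex n, ENNReal.ofReal (corner l i) = ENNReal.ofReal (1 / (n + 1)!) := by
  have hset : {p : ℝ × (Fin n → ℝ) | p.2 ∈ cornerSimplex n ∧ 0 ≤ p.1 ∧ p.1 ≤ corner p.2 i} =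
      {p | 0 ≤ p.1 ∧ ∀ k, p.1 * (Pi.single i 1 : Fin (n + 1) → ℝ) k ≤ corner p.2 k} := by
    ext p
    simp only [cornerSimplex, Set.mem_ofPred_eq]
    constructor
    · rintro ⟨h1, h2, h3⟩
      refine ⟨h2, fun k => ?_⟩
      by_cases hk : k = i
      · subst hk; simpa using h3
      · simpa [hk] using h1 k
    · rintro ⟨h1, h2⟩
      have hi : p.1 ≤ corner p.2 i := by simpa using h2 i
      refine ⟨fun k => ?_, h1, hi⟩
      by_cases hk : k = i
      · subst hk; exact h1.trans hi
      · simpa [hk] using h2 k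
  rw [← volume_region_eq_lintegral isClosed_cornerSimplex.measurableSet
    (continuous_corner i).measurable, hset, volume_region_corner _ (by simp),
    volume_cornerSimplex, ← ENNReal.ofReal_mul (by simp; positivity), Nat.factorial_succ]
  congr 1
  simp
  field_simp

lemma lintegral_min_corner :
    ∫⁻ l in cornerSimplex n,
      ENNReal.ofReal (Finset.univ.inf' Finset.univ_nonempty (corner l)) =
      ENNReal.ofReal (1 / ((n + 1) * (n + 1)!)) := by
  have hset : {p : ℝ × (Fin n → ℝ) | p.2 ∈ cornerSimplex n ∧ 0 ≤ p.1 ∧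
      p.1 ≤ Finset.univ.inf' Finset.univ_nonempty (corner p.2)} =
      {p | 0 ≤ p.1 ∧ ∀ k, p.1 * (fun _ => 1 : Fin (n + 1) → ℝ) k ≤ corner p.2 k} := by
    ext p
    simp only [cornerSimplex, Set.mem_ofPred_eq, Finset.le_inf'_iff, mul_one, Finset.mem_univ,
      true_imp_iff]
    exact ⟨fun h => h.2, fun h => ⟨fun k => h.1.trans (h.2 k), h⟩⟩
  rw [← volume_region_eq_lintegral isClosed_cornerSimplex.measurableSet
    (Continuous.finset_inf'_apply _ fun i _ => continuous_corner i).measurable, hset,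
    volume_region_corner _ (by simp; positivity),
    volume_cornerSimplex, ← ENNReal.ofReal_mul (by simp; positivity), Nat.factorial_succ]
  congr 1
  simp
  field_simp

/-! ### Volume -/

/-- The base simplex is the image of `cornerSimplex n` under an affine map, with linear part the
identity plus the all-ones matrix, whose determinant is `n + 1`. -/
lemma lintegral_bary {F : (Fin (n + 1) → ℝ) → ENNReal} (hF : Measurable F) :
    ∫⁻ x : Fin n → ℝ, F (bary x) =
      ENNReal.ofReal (n + 1) * ∫⁻ l : Fin n → ℝ, F (corner l) := by
  set M : Matrix (Fin n) (Fin n) ℝ :=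
    1 + (Matrix.replicateCol Unit 1 : Matrix (Fin n) Unit ℝ) *
      (Matrix.replicateRow Unit 1 : Matrix Unit (Fin n) ℝ) with hM
  have hdet : M.det = n + 1 := by
    rw [hM, Matrix.det_one_add_replicateCol_mul_replicateRow]
    simp [dotProduct, add_comm]
  have hMl (l : Fin n → ℝ) (k : Fin n) : Matrix.toLin' M l k = l k + ∑ i, l i := by
    rw [hM, Matrix.toLin'_apply, Matrix.add_mulVec, Matrix.one_mulVec]
    simp [Matrix.mulVec, dotProduct, Matrix.mul_apply]
  have hbary (l : Fin n → ℝ) : bary (Matrix.toLin' M l - 1) = corner l := by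
    ext i
    refine Fin.lastCases ?_ (fun k => ?_) i <;>
    · simp [-Matrix.toLin'_apply, hMl, Finset.sum_add_distrib]
      field_simp
      ring
  have hmeas : Measurable fun x : Fin n → ℝ => F (bary (x - 1)) :=
    hF.comp (measurable_pi_iff.2 fun i => ((continuous_bary i).comp (by fun_prop)).measurable)
  have hmap := Real.map_matrix_volume_pi_eq_smul_volume_pi (M := M) (by rw [hdet]; positivity)
  calc ∫⁻ x : Fin n → ℝ, F (bary x) = ∫⁻ x : Fin n → ℝ, F (bary (x - 1)) :=
        (lintegral_sub_right_eq_self (fun x => F (bary x)) 1).symm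
    _ = ENNReal.ofReal (n + 1) * ∫⁻ x, F (bary (x - 1))
          ∂(Measure.map (Matrix.toLin' M) volume) := by
        rw [hmap, lintegral_smul_measure, smul_eq_mul, ← mul_assoc,
          ← ENNReal.ofReal_mul (by positivity), hdet, abs_of_pos (by positivity),
          mul_inv_cancel₀ (by positivity), ENNReal.ofReal_one, one_mul]
    _ = _ := by
        rw [lintegral_map hmeas (LinearMap.continuous_of_finiteDimensional _).measurable]
        simp only [hbary]

/-- The height of the polytope of prism type above the point of the base simplex with barycentric
coordinates `b`. -/
noncomputable def height (j c : ℕ) (b : Fin (n + 1) → ℝ) : ℝ :=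
  c + ∑ i, extraHeight j i * b i + ((n : ℝ) + 1 - j) * Finset.univ.inf' Finset.univ_nonempty b

lemma continuous_height (j c : ℕ) : Continuous (height (n := n) j c) := by
  have : Continuous fun b : Fin (n + 1) → ℝ => Finset.univ.inf' Finset.univ_nonempty b :=
    Continuous.finset_inf'_apply _ fun i _ => continuous_apply i
  unfold height
  fun_prop

lemma le_height_iff {j : ℕ} (c : ℕ) (hj : j ≤ n) (x : Fin n → ℝ) (h : ℝ) :
    h ≤ height j c (bary x) ↔ ∀ k, h ≤ roof j c x k := by
  have hj' : (0 : ℝ) ≤ (n : ℝ) + 1 - j := by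
    have : (j : ℝ) ≤ n := by exact_mod_cast hj
    linarith
  constructor
  · intro hh k
    refine hh.trans ?_
    unfold height roof
    gcongr
    exact Finset.inf'_le _ (Finset.mem_univ k)
  · intro hall
    obtain ⟨k, -, hk⟩ := Finset.exists_mem_eq_inf' Finset.univ_nonempty (bary x)
    rw [height, hk]
    exact hall k

lemma lintegral_height_corner {j : ℕ} (c : ℕ) (hj : j ≤ n) :
    ∫⁻ l in cornerSimplex n, ENNReal.ofReal (height j c (corner l)) =
      ENNReal.ofReal (c / n ! + j / (n + 1)! + (n + 1 - j) / ((n + 1) * (n + 1)!)) := by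
  have hj' : (0 : ℝ) ≤ (n : ℝ) + 1 - j := by
    have : (j : ℝ) ≤ n := by exact_mod_cast hj
    linarith
  have hmc (i : Fin (n + 1)) : Measurable fun l : Fin n → ℝ => corner l i :=
    (continuous_corner i).measurable
  have hmm : Measurable fun l : Fin n → ℝ => Finset.univ.inf' Finset.univ_nonempty (corner l) :=
    (Continuous.finset_inf'_apply _ fun i _ => continuous_corner i).measurable
  have hsplit : ∀ l ∈ cornerSimplex n, ENNReal.ofReal (height j c (corner l)) =
      ENNReal.ofReal c + ∑ i, ENNReal.ofReal (extraHeight j i) * ENNReal.ofReal (corner l i) +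
        ENNReal.ofReal (n + 1 - j) *
          ENNReal.ofReal (Finset.univ.inf' Finset.univ_nonempty (corner l)) := by
    intro l hl
    have hterm (i : Fin (n + 1)) : 0 ≤ (extraHeight j i : ℝ) * corner l i :=
      mul_nonneg (by positivity) (hl i)
    have hsum := Finset.sum_nonneg fun i (_ : i ∈ Finset.univ) => hterm i
    have hmin : 0 ≤ Finset.univ.inf' Finset.univ_nonempty (corner l) :=
      (Finset.le_inf'_iff _ _).2 fun i _ => hl i
    rw [height, ENNReal.ofReal_add (by positivity) (by positivity),
      ENNReal.ofReal_add (by positivity) hsum, ENNReal.ofReal_mul hj',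
      ENNReal.ofReal_sum_of_nonneg fun i _ => hterm i]
    simp only [ENNReal.ofReal_mul (Nat.cast_nonneg _)]
  rw [setLIntegral_congr_fun isClosed_cornerSimplex.measurableSet hsplit,
    lintegral_add_right _ (by fun_prop), lintegral_add_right _ (by fun_prop),
    lintegral_finsetSum _ (by fun_prop), lintegral_const_mul _ (by fun_prop),
    lintegral_min_corner, setLIntegral_const, volume_cornerSimplex]
  have hterm (i : Fin (n + 1)) : ∫⁻ l in cornerSimplex n,
      ENNReal.ofReal (extraHeight j i) * ENNReal.ofReal (corner l i) =
        ENNReal.ofReal (extraHeight j i * (1 / (n + 1)!)) := by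
    rw [lintegral_const_mul _ (by fun_prop), lintegral_corner,
      ENNReal.ofReal_mul (Nat.cast_nonneg _)]
  have hextra : (∑ i : Fin (n + 1), (extraHeight j i : ℝ)) = j := by
    exact_mod_cast sum_extraHeight hj
  rw [Finset.sum_congr rfl fun i _ => hterm i,
    ← ENNReal.ofReal_sum_of_nonneg fun i _ => by positivity, ← Finset.sum_mul, hextra,
    ← ENNReal.ofReal_mul (by positivity), ← ENNReal.ofReal_mul hj',
    ← ENNReal.ofReal_add (by positivity) (by positivity),
    ← ENNReal.ofReal_add (by positivity) (by positivity)]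
  simp only [mul_one_div]

lemma vol_prismType {j : ℕ} (c : ℕ) (hj : j ≤ n) :
    vol (prismType (n + 1) j c) =
      (c * ((n : ℝ) + 1) ^ 2 + j * ((n : ℝ) + 1) + ((n : ℝ) + 1) - j) / (n + 1)! := by
  have hj' : (0 : ℝ) ≤ (n : ℝ) + 1 - j := by
    have : (j : ℝ) ≤ n := by exact_mod_cast hj
    linarith
  have hpre : prismRegion n j c = MeasurableEquiv.piFinSuccAbove (fun _ => ℝ) (Fin.last n) ⁻¹'
      {p | p.2 ∈ {x | ∀ i, 0 ≤ bary x i} ∧ 0 ≤ p.1 ∧ p.1 ≤ height j c (bary p.2)} := by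
    ext y
    obtain ⟨x, h, rfl⟩ := exists_point y
    have : MeasurableEquiv.piFinSuccAbove (fun _ => ℝ) (Fin.last n) (point x h) = (h, x) := by
      simp [MeasurableEquiv.piFinSuccAbove_apply]
    rw [Set.mem_preimage, this, point_mem_prismRegion]
    simp only [Set.mem_ofPred_eq, le_height_iff c hj]
  have hmp := volume_preserving_piFinSuccAbove (fun _ : Fin (n + 1) => ℝ) (Fin.last n)
  have hpos : MeasurableSet {b : Fin (n + 1) → ℝ | ∀ i, 0 ≤ b i} := by
    simp only [Set.ofPred_forall]
    exact .iInter fun i => measurableSet_le measurable_const (measurable_pi_apply i)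
  have hbary : Measurable (bary (n := n)) :=
    measurable_pi_iff.2 fun i => (continuous_bary i).measurable
  have hmeas := (continuous_height (n := n) j c).measurable
  have hF : Measurable ({b : Fin (n + 1) → ℝ | ∀ i, 0 ≤ b i}.indicator
      fun b => ENNReal.ofReal (height j c b)) := hmeas.ennreal_ofReal.indicator hpos
  rw [vol, prismType_eq_prismRegion c hj, measureReal_def, hpre, hmp.measure_preimage_equiv]
  refine (congrArg ENNReal.toReal
    (volume_region_eq_lintegral (hbary hpos) (hmeas.comp hbary))).trans ?_
  rw [← lintegral_indicator (hbary hpos)]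
  have h1 := lintegral_bary hF
  have h2 : ∫⁻ l : Fin n → ℝ, {b : Fin (n + 1) → ℝ | ∀ i, 0 ≤ b i}.indicator
      (fun b => ENNReal.ofReal (height j c b)) (corner l) =
      ∫⁻ l in cornerSimplex n, ENNReal.ofReal (height j c (corner l)) := by
    rw [← lintegral_indicator isClosed_cornerSimplex.measurableSet]
    rfl
  rw [h2, lintegral_height_corner c hj, ← ENNReal.ofReal_mul (by positivity)] at h1
  refine (congrArg ENNReal.toReal (show _ = _ from h1)).trans ?_
  rw [ENNReal.toReal_ofReal (by positivity), Nat.factorial_succ]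
  push_cast
  field_simp
  ring

end LatticePolytope

theorem mainTheorem2 (d c j : ℕ) (hd : 3 ≤ d) (hj : j ≤ d - 1) :
    LatticePolytope.IsLatticePolytope (LatticePolytope.prismType d j c) ∧
    LatticePolytope.dim (LatticePolytope.prismType d j c) = d ∧
    (LatticePolytope.prismType d j c).extremePoints ℝ =
      LatticePolytope.prismTypeVertices d j c ∧
    LatticePolytope.numBoundary (LatticePolytope.prismType d j c) = c * d + d + 2 + j ∧
    LatticePolytope.numInterior (LatticePolytope.prismType d j c) = c ∧
    LatticePolytope.vol (LatticePolytope.prismType d j c) =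
      ((c : ℝ) * (d : ℝ) ^ 2 + (j : ℝ) * (d : ℝ) + (d : ℝ) - (j : ℝ)) / (d ! : ℝ) ∧
    (1 ≤ c → LatticePolytope.IsCastelnuovo (LatticePolytope.prismType d j c)) := by
  obtain ⟨n, rfl⟩ : ∃ n, d = n + 1 := ⟨d - 1, by omega⟩
  rw [Nat.add_sub_cancel] at hj
  have hn : 1 ≤ n := by omega
  have hlat := LatticePolytope.isLatticePolytope_prismType c hj
  have hdim := LatticePolytope.dim_prismType c hj
  have hb := LatticePolytope.numBoundary_prismType c hn hj
  have hi := LatticePolytope.numInterior_prismType c hn hj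
  have hv := LatticePolytope.vol_prismType c hj
  refine ⟨hlat, hdim, LatticePolytope.extremePoints_prismType c hn hj, hb, hi,
    by rw [hv]; push_cast; rfl, fun hc => ⟨hlat, hdim, by omega, ?_⟩⟩
  rw [hv, hi, hb]
  push_cast
  ring
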